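/- Index logic over a finite relational vocabulary $\sigma$ is the following two-sorted logic on finite $\sigma$-structures $\mathbf A$ with domain $A=\{0,\dots,n-1\}$, ordered in the usual way. Variables $x,y,\dots$ of sort $\mathbf v$ range over $A$; variables $\mathtt x,\mathtt y,\dots$ of sort $\mathbf n$ range over $\mathrm{Num}(\mathbf A)=\{0,\dots,\lceil\log_2 n\rceil-1\}$; a relation variable $X$ of arity $k$ ranges over the subsets of $\mathrm{Num}(\mathbf A)^k$. A valuation assigns to every variable a value in its range. The formulae are generated by $$\varphi ::= x\le y \mid \mathtt x\le\mathtt y \mid R(x_1,\dots,x_k) \mid X(\mathtt x_1,\dots,\mathtt x_k) \mid (\varphi\wedge\varphi)\mid\neg\varphi\mid[\mathrm{IFP}_{\bar{\mathtt x},X}\,\varphi]\bar{\mathtt y}\mid x=\mathit{index}\{\mathtt x:\varphi\}\mid\exists x\,(x=\mathit{index}\{\mathtt x:\alpha\}\wedge\varphi)\mid\exists\mathtt x\,\varphi,$$ where $R\in\sigma$, the formula $\alpha$ is a formula in which $x$ does not occur free, $\bar{\mathtt x}$ is a tuple of pairwise distinct variables, and $\bar{\mathtt x},\bar{\mathtt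 y}$ have the arity of $X$ as their length. The order, the connectives and the quantifiers are interpreted as usual; $x=\mathit{index}\{\mathtt x:\varphi\}$ holds iff for every $j\in\mathrm{Num}(\mathbf A)$ the bit of weight $2^j$ in the binary representation of the value of $x$ is $1$ exactly when $\varphi$ holds with $\mathtt x$ set to $j$; and $[\mathrm{IFP}_{\bar{\mathtt x},X}\,\varphi]\bar{\mathtt y}$ holds iff the value of $\bar{\mathtt y}$ lies in $\bigcup_{i}S^i$, where $S^0=\emptyset$, $S^{i+1}=S^i\cup F(S^i)$, and $F(S)$ is the set of tuples $\bar a$ such that $\varphi$ holds with $X$ set to $S$ and $\bar{\mathtt x}$ set to $\bar a$. **Lemma 3.** Let $P$ and $Q$ be unary relation symbols. There is no index logic formula $\varphi$ over the vocabulary $\{P,Q\}$ such that for all $\{P,Q\}$-structures $\mathbf A$ in which $P^{\mathbf A}$ and $Q^{\mathbf A}$ are disjoint singleton sets $\{l\}$ and $\{m\}$, respectively, and for all valuations $\mathit{val}$ over $\mathbf A$, $$\mathbf A,\mathit{val}\models\varphi\quad\text{if and only if}\quad l<m .$$ -/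

import Mathlib

namespace IndexLogic

universe u v

/-- Expressions of index logic over the vocabulary `L` (constants are the function symbols of
arity `0`). Variables of sort **v**, variables of sort **n**, and, for every arity `k`, relation
variables of arity `k` are three separate supplies, each indexed by `ℕ`. First-order terms of
sort **v** are Mathlib's terms `L.Term ℕ`; the terms of sort **n** are just variables. The side
condition of the guarded existential quantifier is imposed by `RawFormula.WellFormed` below. -/
inductive RawFormula (L : FirstOrder.Language.{u, v}) : Type (max u v)
  /-- `t₁ ≤ t₂`, for terms of sort **v**. -/
  | leV (t₁ t₂ : L.Term ℕ) : RawFormula L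
  /-- `x ≤ y`, for variables of sort **n**. -/
  | leN (x y : ℕ) : RawFormula L
  /-- `R(t₁, …, t_k)`. -/
  | rel {k : ℕ} (R : L.Relations k) (ts : Fin k → L.Term ℕ) : RawFormula L
  /-- `X(x₁, …, x_k)`, for the `X`-th relation variable of arity `k`. -/
  | relVar {k : ℕ} (X : ℕ) (xs : Fin k → ℕ) : RawFormula L
  /-- `φ ∧ ψ`. -/
  | and (φ ψ : RawFormula L) : RawFormula L
  /-- `¬ φ`. -/
  | not (φ : RawFormula L) : RawFormula L
  /-- `[IFP_{xs, X} φ] ys`, where `xs` is a tuple of pairwise distinct variables. -/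
  | ifp {k : ℕ} (X : ℕ) (xs : Fin k ↪ ℕ) (φ : RawFormula L) (ys : Fin k → ℕ) : RawFormula L
  /-- `t = index{i : φ(i)}`, where `i` is a variable of sort **n**. -/
  | eqIndex (t : L.Term ℕ) (i : ℕ) (φ : RawFormula L) : RawFormula L
  /-- `∃ x (x = index{i : α(i)} ∧ φ)`, where `x` is of sort **v** and `i` of sort **n**. -/
  | exIndex (x : ℕ) (i : ℕ) (α φ : RawFormula L) : RawFormula L
  /-- `∃ i φ`, where `i` is a variable of sort **n**. -/
  | exN (i : ℕ) (φ : RawFormula L) : RawFormula L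

namespace RawFormula

variable {L : FirstOrder.Language.{u, v}}

/-- `φ.FreeV x`: the variable `x` of sort **v** occurs free in `φ`. -/
def FreeV (x : ℕ) : RawFormula L → Prop
  | leV t₁ t₂ => x ∈ t₁.varFinset ∨ x ∈ t₂.varFinset
  | leN _ _ => False
  | rel _ ts => ∃ j, x ∈ (ts j).varFinset
  | relVar _ _ => False
  | and φ ψ => φ.FreeV x ∨ ψ.FreeV x
  | not φ => φ.FreeV x
  | ifp _ _ φ _ => φ.FreeV x
  | eqIndex t _ φ => x ∈ t.varFinset ∨ φ.FreeV x
  | exIndex y _ α φ => x ≠ y ∧ (α.FreeV x ∨ φ.FreeV x)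
  | exN _ φ => φ.FreeV x

/-- In every subformula `∃ x (x = index{i : α(i)} ∧ φ)`, the variable `x` is not free in `α`. -/
def WellFormed : RawFormula L → Prop
  | leV _ _ => True
  | leN _ _ => True
  | rel _ _ => True
  | relVar _ _ => True
  | and φ ψ => φ.WellFormed ∧ ψ.WellFormed
  | not φ => φ.WellFormed
  | ifp _ _ φ _ => φ.WellFormed
  | eqIndex _ _ φ => φ.WellFormed
  | exIndex x _ α φ => ¬ α.FreeV x ∧ α.WellFormed ∧ φ.WellFormed
  | exN _ φ => φ.WellFormed

end RawFormula

/-- The formulae of index logic over the vocabulary `L`. -/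
abbrev Formula (L : FirstOrder.Language.{u, v}) : Type (max u v) := {φ : RawFormula L // φ.WellFormed}

/-- The number sort `{0, …, ⌈log₂ n⌉ - 1}` of an ordered structure with domain
`{0, …, n - 1}`. -/
abbrev Num (n : ℕ) : Type := Fin (Nat.clog 2 n)

/-- Valuations over a structure with domain `{0, …, n - 1}`. -/
structure Valuation (n : ℕ) where
  /-- values of the variables of sort **v** -/
  elt : ℕ → Fin n
  /-- values of the variables of sort **n** -/
  num : ℕ → Num n
  /-- values of the relation variables, `rel k X` for the `X`-th one of arity `k` -/
  rel : (k : ℕ) → ℕ → Set (Fin k → Num n)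

namespace Valuation

variable {n : ℕ}

/-- `val(a/x)` for a variable `x` of sort **v**. -/
def setElt (val : Valuation n) (x : ℕ) (a : Fin n) : Valuation n :=
  { val with elt := Function.update val.elt x a }

/-- `val(j/i)` for a variable `i` of sort **n**. -/
def setNum (val : Valuation n) (i : ℕ) (j : Num n) : Valuation n :=
  { val with num := Function.update val.num i j }

/-- `val(as/xs)` for a tuple `xs` of pairwise distinct variables of sort **n**. -/
noncomputable def setTuple (val : Valuation n) {k : ℕ} (xs : Fin k ↪ ℕ) (as : Fin k → Num n) :
    Valuation n :=
  { val with num := Function.extend xs as val.num }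

/-- `val(S/X)` for the `X`-th relation variable of arity `k`. -/
def setRel (val : Valuation n) {k : ℕ} (X : ℕ) (S : Set (Fin k → Num n)) : Valuation n :=
  { val with rel := Function.update val.rel k (Function.update (val.rel k) X S) }

end Valuation

/-- The inflationary fixed point of `F`: the union of the sets `S⁰ = ∅`, `Sⁱ⁺¹ = Sⁱ ∪ F(Sⁱ)`. -/
def inflFix {B : Type*} (F : Set B → Set B) : Set B :=
  ⋃ i : ℕ, (fun S => S ∪ F S)^[i] ∅

/-- Satisfaction `A, val ⊨ φ` in a structure with domain `{0, …, n - 1}`, ordered as usual. -/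
def RawFormula.Realize {L : FirstOrder.Language.{u, v}} {n : ℕ} [L.Structure (Fin n)] :
    RawFormula L → Valuation n → Prop
  | .leV t₁ t₂, val => t₁.realize val.elt ≤ t₂.realize val.elt
  | .leN x y, val => val.num x ≤ val.num y
  | .rel R ts, val => FirstOrder.Language.Structure.RelMap R fun j => (ts j).realize val.elt
  | .relVar (k := k) X xs, val => (fun j => val.num (xs j)) ∈ val.rel k X
  | .and φ ψ, val => φ.Realize val ∧ ψ.Realize val
  | .not φ, val => ¬ φ.Realize val
  | .ifp X xs φ ys, val =>
      (fun j => val.num (ys j)) ∈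
        inflFix fun S => {as | φ.Realize ((val.setRel X S).setTuple xs as)}
  | .eqIndex t i φ, val =>
      ∀ j : Num n, ((t.realize val.elt : Fin n) : ℕ).testBit j = true ↔ φ.Realize (val.setNum i j)
  | .exIndex x i α φ, val =>
      ∃ a : Fin n,
        (∀ j : Num n, (a : ℕ).testBit j = true ↔ α.Realize ((val.setElt x a).setNum i j)) ∧
          φ.Realize (val.setElt x a)
  | .exN i φ, val => ∃ j : Num n, φ.Realize (val.setNum i j)

/-- The symbols of the vocabulary `{P, Q}`. -/
inductive PQRel : ℕ → Type
  | P : PQRel 1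
  | Q : PQRel 1

/-- The vocabulary `{P, Q}` with two unary relation symbols. -/
def langPQ : FirstOrder.Language.{0, 0} := ⟨fun _ => Empty, PQRel⟩

/-- The symbol `P`. -/
def symP : langPQ.Relations 1 := PQRel.P

/-- The symbol `Q`. -/
def symQ : langPQ.Relations 1 := PQRel.Q

/-- The interpretation of a unary relation symbol, as a set of elements of the structure. -/
def unaryInterp {L : FirstOrder.Language.{u, v}} {n : ℕ} [L.Structure (Fin n)] (R : L.Relations 1) :
    Set (Fin n) :=
  {a | FirstOrder.Language.Structure.RelMap R ![a]}

end IndexLogic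

/-! Put N = ⌈log₂ n⌉. Evaluating a fixed formula under a fixed valuation inspects the relations on
only polylogarithmically many elements: numeric quantification ranges over N values, and a guarded
element quantifier admits at most one witness, since an element is determined by its N bits.
`exists_supports_card_le` makes this precise by induction on the formula.

For large n = 2^N, take such a support `T` in the structure where `P` and `Q` are empty. Two
distinct elements l, m lie outside `T`. Placing `P`, `Q` at l, m or at m, l is invisible on `T`, so
the formula has the same truth value both times, whereas l < m and m < l do not. -/

namespace IndexLogic

open FirstOrder FirstOrder.Language

universe u v

variable {L : FirstOrder.Language.{u, v}} {n : ℕ}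

/-! ### Independence of non-free variables. -/

namespace Valuation

theorem setElt_setElt_comm (val : Valuation n) {x y : ℕ} (h : x ≠ y) (a b : Fin n) :
    (val.setElt x a).setElt y b = (val.setElt y b).setElt x a := by
  simp [setElt, Function.update_comm h]

theorem setElt_setElt_self (val : Valuation n) (x : ℕ) (a b : Fin n) :
    (val.setElt x a).setElt x b = val.setElt x b := by
  simp [setElt]

end Valuation

/-- A term does not depend on the value of a variable that does not occur in it. -/
theorem realize_update_of_notMem_varFinset [L.Structure (Fin n)] (t : L.Term ℕ)
    (e : ℕ → Fin n) {x : ℕ} (a : Fin n) (h : x ∉ t.varFinset) :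
    t.realize (Function.update e x a) = t.realize e := by
  induction t with
  | var y =>
    have hy : y ≠ x := by rintro rfl; simp [Term.varFinset] at h
    simp [hy]
  | func f ts ih =>
    simp only [Term.varFinset, Finset.mem_biUnion, Finset.mem_univ, true_and, not_exists] at h
    simp only [Term.realize_func]
    congr 1
    funext j
    exact ih j (h j)

/-- A formula does not depend on the value of a variable of sort **v** that is not free in it. -/
theorem RawFormula.realize_setElt_of_not_freeV [L.Structure (Fin n)] (φ : RawFormula L) {x : ℕ}
    (h : ¬ φ.FreeV x) (val : Valuation n) (a : Fin n) :
    φ.Realize (val.setElt x a) ↔ φ.Realize val := by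
  induction φ generalizing val with
  | leV t₁ t₂ =>
    simp only [FreeV, not_or] at h
    simp only [Realize, Valuation.setElt, realize_update_of_notMem_varFinset _ _ _ h.1,
      realize_update_of_notMem_varFinset _ _ _ h.2]
  | leN => rfl
  | rel R ts =>
    simp only [FreeV, not_exists] at h
    simp only [Realize, Valuation.setElt, realize_update_of_notMem_varFinset _ _ _ (h _)]
  | relVar => rfl
  | and φ ψ ihφ ihψ =>
    simp only [FreeV, not_or] at h
    exact and_congr (ihφ h.1 val) (ihψ h.2 val)
  | not φ ih => exact not_congr (ih h val)
  | @ifp k X xs φ ys ih =>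
    have key : (fun S : Set (Fin k → Num n) => {as | φ.Realize (((val.setElt x a).setRel X S).setTuple xs as)}) =
        fun S => {as | φ.Realize ((val.setRel X S).setTuple xs as)} := by
      funext S
      ext as
      exact ih h ((val.setRel X S).setTuple xs as)
    simp only [Realize, key]
    rfl
  | eqIndex t i φ ih =>
    simp only [FreeV, not_or] at h
    refine forall_congr' fun j => ?_
    have ht : t.realize (val.setElt x a).elt = t.realize val.elt :=
      realize_update_of_notMem_varFinset _ _ _ h.1
    rw [ht]
    exact iff_congr Iff.rfl (ih h.2 (val.setNum i j))
  | exIndex y i α φ ihα ihφ =>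
    simp only [FreeV, not_and, not_or] at h
    refine exists_congr fun b => ?_
    by_cases hxy : x = y
    · subst hxy
      rw [Valuation.setElt_setElt_self]
    · obtain ⟨hα, hφ⟩ := h hxy
      rw [Valuation.setElt_setElt_comm _ hxy]
      exact and_congr
        (forall_congr' fun j =>
          iff_congr Iff.rfl (ihα hα ((val.setElt y b).setNum i j)))
        (ihφ hφ _)
  | exN i φ ih => exact exists_congr fun j => ih h (val.setNum i j)

/-! ### Supports. -/

/-- Two structures with domain `{0, …, n - 1}` have the same relations between elements of `T`. -/
def AgreeOn (M M' : L.Structure (Fin n)) (T : Finset (Fin n)) : Prop :=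
  ∀ (k : ℕ) (R : L.Relations k) (a : Fin k → Fin n), (∀ j, a j ∈ T) →
    (M'.RelMap R a ↔ M.RelMap R a)

theorem AgreeOn.mono {M M' : L.Structure (Fin n)} {T T' : Finset (Fin n)}
    (h : AgreeOn M M' T) (hT : T' ⊆ T) : AgreeOn M M' T' :=
  fun k R a ha => h k R a fun j => hT (ha j)

/-- `T` supports `φ` under `val` in `M`: the truth value of `φ` is determined by the relations of
`M` between elements of `T`. -/
def Supports (M : L.Structure (Fin n)) (T : Finset (Fin n)) (φ : RawFormula L)
    (val : Valuation n) : Prop :=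
  ∀ M' : L.Structure (Fin n), AgreeOn M M' T →
    (@RawFormula.Realize L n M' φ val ↔ @RawFormula.Realize L n M φ val)

theorem realize_term_eq [L.IsRelational] (M M' : L.Structure (Fin n)) (t : L.Term ℕ)
    (e : ℕ → Fin n) : @Term.realize L (Fin n) M' ℕ e t = @Term.realize L (Fin n) M ℕ e t := by
  cases t with
  | var => rfl
  | func f => exact isEmptyElim f

/-- The elements of a domain of size `n` are determined by their bits in `Num n`. -/
theorem eq_of_testBit_num {a b : Fin n}
    (h : ∀ j : Num n, (a : ℕ).testBit j = (b : ℕ).testBit j) : a = b := by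
  have hn : n ≤ 2 ^ Nat.clog 2 n := Nat.le_pow_clog one_lt_two n
  refine Fin.ext (Nat.eq_of_testBit_eq fun i => ?_)
  by_cases hi : i < Nat.clog 2 n
  · exact h ⟨i, hi⟩
  · have hp : 2 ^ Nat.clog 2 n ≤ 2 ^ i := Nat.pow_le_pow_right two_pos (not_lt.mp hi)
    rw [Nat.testBit_lt_two_pow (a.2.trans_le (hn.trans hp)),
      Nat.testBit_lt_two_pow (b.2.trans_le (hn.trans hp))]

/-! ### Stages of inflationary fixed points. -/

/-- The `i`-th stage of the inflationary iteration of `F`. -/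
def stage {B : Type*} (F : Set B → Set B) (i : ℕ) : Set B :=
  (fun S => S ∪ F S)^[i] ∅

theorem stage_succ {B : Type*} (F : Set B → Set B) (i : ℕ) :
    stage F (i + 1) = stage F i ∪ F (stage F i) :=
  Function.iterate_succ_apply' _ _ _

theorem stage_mono {B : Type*} (F : Set B → Set B) : Monotone (stage F) :=
  monotone_nat_of_le_succ fun i => by
    rw [stage_succ]
    exact Set.subset_union_left

/-- If `G` agrees with `F` on all stages of `F`, then both have the same fixed point. -/
theorem inflFix_congr {B : Type*} {F G : Set B → Set B}
    (h : ∀ i, G (stage F i) = F (stage F i)) : inflFix G = inflFix F := by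
  have key : ∀ i, stage G i = stage F i := by
    intro i
    induction i with
    | zero => rfl
    | succ i ih => rw [stage_succ, stage_succ, ih, h]
  exact Set.iUnion_congr key

/-- An inflationary iteration has at most `|B| + 1` different stages. -/
theorem exists_finset_stages {B : Type*} [Fintype B] (F : Set B → Set B) :
    ∃ s : Finset (Set B), s.card ≤ Fintype.card B + 1 ∧ ∀ i, stage F i ∈ s := by
  classical
  refine ⟨(Set.toFinite (Set.range (stage F))).toFinset, ?_, fun i => by simp⟩
  rw [← Finset.card_range (Fintype.card B + 1)]
  -- The stages form a chain, so distinct stages have distinct cardinalities, all in {0, …, |B|}.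
  refine Finset.card_le_card_of_injOn Set.ncard ?_ ?_
  · intro S _
    simp only [Finset.coe_range, Set.mem_Iio, Nat.lt_succ_iff]
    simpa [Nat.card_eq_fintype_card] using Set.ncard_le_card S
  · intro S hS T hT hST
    simp only [Set.Finite.coe_toFinset, Set.mem_range] at hS hT
    obtain ⟨i, rfl⟩ := hS
    obtain ⟨j, rfl⟩ := hT
    rcases le_total i j with hij | hij
    · exact Set.eq_of_subset_of_ncard_le (stage_mono F hij) hST.ge (Set.toFinite _)
    · exact (Set.eq_of_subset_of_ncard_le (stage_mono F hij) hST.le (Set.toFinite _)).symm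

/-- The base is at least 2 even when N = 0, so one extra exponent absorbs the doubling. -/
theorem add_le_pow_of_le_pow {a b N c d : ℕ} (ha : a ≤ (N + 2) ^ c) (hb : b ≤ (N + 2) ^ d) :
    a + b ≤ (N + 2) ^ (c + d + 1) := by
  have h1 : (N + 2) ^ c ≤ (N + 2) ^ (c + d) := Nat.pow_le_pow_right (by omega) (by omega)
  have h2 : (N + 2) ^ d ≤ (N + 2) ^ (c + d) := Nat.pow_le_pow_right (by omega) (by omega)
  rw [pow_succ]
  nlinarith [Nat.zero_le ((N + 2) ^ (c + d) * N)]

/-! ### Polylogarithmic supports, by induction on formulae. -/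

/-- Every formula of index logic has, in every structure and under every valuation, a support of
size polylogarithmic in the size of the structure. -/
theorem exists_supports_card_le [L.IsRelational] (φ : RawFormula L) (hφ : φ.WellFormed) :
    ∃ d : ℕ, ∀ (n : ℕ) (M : L.Structure (Fin n)) (val : Valuation n),
      ∃ T : Finset (Fin n), T.card ≤ (Nat.clog 2 n + 2) ^ d ∧ Supports M T φ val := by
  classical
  induction φ with
  | leV t₁ t₂ =>
    refine ⟨0, fun n M val => ⟨∅, by simp, fun M' _ => ?_⟩⟩
    simp only [RawFormula.Realize, realize_term_eq M M']
  | leN x y => exact ⟨0, fun n M val => ⟨∅, by simp, fun M' _ => Iff.rfl⟩⟩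
  | @rel k R ts =>
    refine ⟨k, fun n M val => ⟨Finset.univ.image fun j => (ts j).realize val.elt, ?_, ?_⟩⟩
    · refine Finset.card_image_le.trans ?_
      rw [Finset.card_univ, Fintype.card_fin]
      exact (Nat.lt_pow_self (by omega)).le
    · intro M' hM'
      simp only [RawFormula.Realize, realize_term_eq M M']
      exact hM' k R _ fun j => Finset.mem_image_of_mem _ (Finset.mem_univ j)
  | relVar X xs => exact ⟨0, fun n M val => ⟨∅, by simp, fun M' _ => Iff.rfl⟩⟩
  | and φ ψ ihφ ihψ =>
    obtain ⟨c, hc⟩ := ihφ hφ.1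
    obtain ⟨d, hd⟩ := ihψ hφ.2
    refine ⟨c + d + 1, fun n M val => ?_⟩
    obtain ⟨T, hT, hTφ⟩ := hc n M val
    obtain ⟨U, hU, hUψ⟩ := hd n M val
    exact ⟨T ∪ U, (Finset.card_union_le T U).trans (add_le_pow_of_le_pow hT hU),
      fun M' hM' => and_congr (hTφ M' (hM'.mono Finset.subset_union_left))
        (hUψ M' (hM'.mono Finset.subset_union_right))⟩
  | not φ ih =>
    obtain ⟨d, hd⟩ := ih hφ
    refine ⟨d, fun n M val => ?_⟩
    obtain ⟨T, hT, hTφ⟩ := hd n M val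
    exact ⟨T, hT, fun M' hM' => not_congr (hTφ M' hM')⟩
  | @ifp k X xs φ ys ih =>
    obtain ⟨d, hd⟩ := ih hφ
    refine ⟨(k + 1) + (k + d), fun n M val => ?_⟩
    set F : Set (Fin k → Num n) → Set (Fin k → Num n) := fun S =>
      {as | φ.Realize ((val.setRel X S).setTuple xs as)} with hF
    -- Only the stages reached in `M` need support: at most N^k + 1 sets, rather than all 2^(N^k)
    -- values of `X`.
    obtain ⟨s, hs, hstage⟩ := exists_finset_stages F
    choose T hT hTφ using hd n M
    refine ⟨s.biUnion fun S => Finset.univ.biUnion fun as =>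
      T ((val.setRel X S).setTuple xs as), ?_, ?_⟩
    · refine (Finset.card_biUnion_le_card_mul _ _ _ fun S _ =>
        Finset.card_biUnion_le_card_mul _ _ _ fun as _ => hT _).trans ?_
      have hcard : Fintype.card (Fin k → Num n) = Nat.clog 2 n ^ k := by simp
      rw [hcard] at hs
      rw [Finset.card_univ, hcard, pow_add _ (k + 1), pow_add _ k d]
      have h1 : Nat.clog 2 n ^ k ≤ (Nat.clog 2 n + 2) ^ k := Nat.pow_le_pow_left (by omega) k
      have h2 : s.card ≤ (Nat.clog 2 n + 2) ^ (k + 1) := by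
        have := Nat.one_le_pow k (Nat.clog 2 n + 2) (by omega)
        rw [pow_succ]
        nlinarith
      exact Nat.mul_le_mul h2 (Nat.mul_le_mul_right _ h1)
    · intro M' hM'
      have key : inflFix (fun S => {as | @RawFormula.Realize L n M' φ
          ((val.setRel X S).setTuple xs as)}) = inflFix F := by
        refine inflFix_congr fun i => ?_
        ext as
        refine hTφ _ M' (hM'.mono ?_)
        exact (Finset.subset_biUnion_of_mem
            (fun as => T ((val.setRel X (stage F i)).setTuple xs as)) (Finset.mem_univ as)).trans
          (Finset.subset_biUnion_of_mem (fun S => Finset.univ.biUnion fun as =>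
            T ((val.setRel X S).setTuple xs as)) (hstage i))
      simp only [RawFormula.Realize, key, hF]
  | eqIndex t i φ ih =>
    obtain ⟨d, hd⟩ := ih hφ
    refine ⟨d + 1, fun n M val => ?_⟩
    choose T hT hTφ using hd n M
    refine ⟨Finset.univ.biUnion fun j => T (val.setNum i j), ?_, fun M' hM' => ?_⟩
    · refine (Finset.card_biUnion_le_card_mul _ _ _ fun j _ => hT _).trans ?_
      rw [Finset.card_univ, Fintype.card_fin, pow_succ, mul_comm]
      gcongr
      omega
    · simp only [RawFormula.Realize, realize_term_eq M M']
      exact forall_congr' fun j => iff_congr Iff.rfl <| hTφ _ M' <| hM'.mono <|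
        Finset.subset_biUnion_of_mem (fun j => T (val.setNum i j)) (Finset.mem_univ j)
  | exIndex x i α φ ihα ihφ =>
    obtain ⟨hx, hwα, hwφ⟩ := hφ
    obtain ⟨c, hc⟩ := ihα hwα
    obtain ⟨d, hd⟩ := ihφ hwφ
    refine ⟨(c + 1) + d + 1, fun n M val => ?_⟩
    choose T hT hTα using hc n M
    choose U hU hUφ using hd n M
    -- The side condition on the guard: as `x` is not free in `α`, one support of `α` serves all
    -- candidates `a`.
    have hfree : ∀ (M' : L.Structure (Fin n)) (a : Fin n) (j : Num n),
        @RawFormula.Realize L n M' α ((val.setElt x a).setNum i j) ↔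
          @RawFormula.Realize L n M' α (val.setNum i j) := fun M' a j =>
      @RawFormula.realize_setElt_of_not_freeV L n M' α x hx (val.setNum i j) a
    have hTcard : (Finset.univ.biUnion fun j => T (val.setNum i j)).card ≤
        (Nat.clog 2 n + 2) ^ (c + 1) := by
      refine (Finset.card_biUnion_le_card_mul _ _ _ fun j _ => hT _).trans ?_
      rw [Finset.card_univ, Fintype.card_fin, pow_succ, mul_comm]
      gcongr
      omega
    have hTmem : ∀ M', AgreeOn M M' (Finset.univ.biUnion fun j => T (val.setNum i j)) →
        ∀ j, @RawFormula.Realize L n M' α (val.setNum i j) ↔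
          @RawFormula.Realize L n M α (val.setNum i j) := fun M' hM' j =>
      hTα _ M' <| hM'.mono <|
        Finset.subset_biUnion_of_mem (fun j => T (val.setNum i j)) (Finset.mem_univ j)
    -- The bits prescribed by `α` are the same in `M` and `M'`, so both have the same unique
    -- candidate or none; `φ` needs support at that candidate only.
    by_cases ha : ∃ a : Fin n, ∀ j : Num n,
        (a : ℕ).testBit j = true ↔ α.Realize (val.setNum i j)
    · obtain ⟨a, ha⟩ := ha
      refine ⟨(Finset.univ.biUnion fun j => T (val.setNum i j)) ∪ U (val.setElt x a),
        (Finset.card_union_le _ _).trans (add_le_pow_of_le_pow hTcard (hU _)), fun M' hM' => ?_⟩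
      refine exists_congr fun b => ?_
      have hα := hTmem M' (hM'.mono Finset.subset_union_left)
      simp only [hfree, hα]
      refine and_congr_right fun hb => ?_
      have hba : b = a := eq_of_testBit_num fun j => by
        rw [Bool.eq_iff_iff, hb j, ha j]
      rw [hba]
      exact hUφ _ M' (hM'.mono Finset.subset_union_right)
    · refine ⟨Finset.univ.biUnion fun j => T (val.setNum i j),
        hTcard.trans (Nat.pow_le_pow_right (by omega) (by omega)), fun M' hM' => ?_⟩
      refine exists_congr fun b => ?_
      simp only [hfree, hTmem M' hM']
      exact and_congr_right fun hb => absurd ⟨b, hb⟩ ha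
  | exN i φ ih =>
    obtain ⟨d, hd⟩ := ih hφ
    refine ⟨d + 1, fun n M val => ?_⟩
    choose T hT hTφ using hd n M
    refine ⟨Finset.univ.biUnion fun j => T (val.setNum i j), ?_, fun M' hM' => ?_⟩
    · refine (Finset.card_biUnion_le_card_mul _ _ _ fun j _ => hT _).trans ?_
      rw [Finset.card_univ, Fintype.card_fin, pow_succ, mul_comm]
      gcongr
      omega
    · exact exists_congr fun j => hTφ _ M' <| hM'.mono <|
        Finset.subset_biUnion_of_mem (fun j => T (val.setNum i j)) (Finset.mem_univ j)

/-! ### Two structures indistinguishable on a support. -/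

instance : langPQ.IsRelational := fun _ => inferInstanceAs (IsEmpty Empty)

/-- The structure in which `P` and `Q` are interpreted by the sets `p` and `q`. -/
@[reducible] def structPQ (p q : Set (Fin n)) : langPQ.Structure (Fin n) where
  funMap f := isEmptyElim f
  RelMap R a :=
    match R with
    | PQRel.P => a 0 ∈ p
    | PQRel.Q => a 0 ∈ q

theorem unaryInterp_symP (p q : Set (Fin n)) :
    @unaryInterp langPQ n (structPQ p q) symP = p := rfl

theorem unaryInterp_symQ (p q : Set (Fin n)) :
    @unaryInterp langPQ n (structPQ p q) symQ = q := rfl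

theorem agreeOn_structPQ {T : Finset (Fin n)} {l m : Fin n} (hl : l ∉ T) (hm : m ∉ T) :
    AgreeOn (structPQ ∅ ∅) (structPQ {l} {m}) T := by
  intro k R a ha
  cases R with
  | P => exact iff_of_false (fun h => hl (Set.mem_singleton_iff.mp h ▸ ha 0)) (Set.notMem_empty _)
  | Q => exact iff_of_false (fun h => hm (Set.mem_singleton_iff.mp h ▸ ha 0)) (Set.notMem_empty _)

/-- The summand 2 leaves room for two elements outside a support. -/
theorem exists_pow_add_two_le_two_pow (d : ℕ) : ∃ N : ℕ, 0 < N ∧ (N + 2) ^ d + 2 ≤ 2 ^ N := by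
  have h := (tendsto_pow_const_div_const_pow_of_one_lt d (one_lt_two : (1 : ℝ) < 2)).eventually
    -- With K = N + 2, the constant 1/8 gives 2(N + 2)^d < 2^N: a factor 4 pays for the shift. Then
    -- 2^N ≥ 4 makes room for the summand 2.
    (gt_mem_nhds (show (0 : ℝ) < 1 / 8 by norm_num))
  obtain ⟨K, hK, hK4⟩ := (h.and (Filter.eventually_ge_atTop 4)).exists
  obtain ⟨N, rfl⟩ : ∃ N, K = N + 2 := ⟨K - 2, by omega⟩
  rw [div_lt_iff₀ (by positivity)] at hK
  have h8 : 8 * (N + 2) ^ d < 2 ^ (N + 2) := by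
    have : (8 : ℝ) * ((N + 2 : ℕ) : ℝ) ^ d < 2 ^ (N + 2) := by linarith
    exact_mod_cast this
  have h4 : 2 ^ 2 ≤ 2 ^ N := Nat.pow_le_pow_right two_pos (by omega)
  refine ⟨N, by omega, ?_⟩
  rw [pow_add] at h8
  omega

end IndexLogic

theorem lemma3 :
    ¬ ∃ φ : IndexLogic.Formula IndexLogic.langPQ,
      ∀ (n : ℕ) [IndexLogic.langPQ.Structure (Fin n)] (l m : Fin n),
        IndexLogic.unaryInterp IndexLogic.symP = {l} →
        IndexLogic.unaryInterp IndexLogic.symQ = {m} →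
        Disjoint ({l} : Set (Fin n)) {m} →
        ∀ val : IndexLogic.Valuation n, φ.1.Realize val ↔ l < m := by
  rintro ⟨φ, hφ⟩
  obtain ⟨d, hd⟩ := IndexLogic.exists_supports_card_le φ.1 φ.2
  obtain ⟨N, hN, hNd⟩ := IndexLogic.exists_pow_add_two_le_two_pow d
  have hclog : Nat.clog 2 (2 ^ N) = N := Nat.clog_pow 2 N one_lt_two
  -- Any valuation would do; one exists because N > 0 makes the number sort nonempty.
  let val : IndexLogic.Valuation (2 ^ N) :=
    ⟨fun _ => ⟨0, by positivity⟩, fun _ => ⟨0, by rw [hclog]; exact hN⟩, fun _ _ => ∅⟩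
  obtain ⟨T, hT, hTφ⟩ := hd (2 ^ N) (IndexLogic.structPQ ∅ ∅) val
  rw [hclog] at hT
  have hcompl : 1 < Tᶜ.card := by
    rw [Finset.card_compl, Fintype.card_fin]
    omega
  obtain ⟨l, hl, m, hm, hlm⟩ := Finset.one_lt_card.mp hcompl
  rw [Finset.mem_compl] at hl hm
  have h1 := @hφ (2 ^ N) (IndexLogic.structPQ {l} {m}) l m
    (IndexLogic.unaryInterp_symP _ _) (IndexLogic.unaryInterp_symQ _ _)
    (Set.disjoint_singleton.mpr hlm) val
  have h2 := @hφ (2 ^ N) (IndexLogic.structPQ {m} {l}) m l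
    (IndexLogic.unaryInterp_symP _ _) (IndexLogic.unaryInterp_symQ _ _)
    (Set.disjoint_singleton.mpr hlm.symm) val
  have h3 : l < m ↔ m < l := by
    rw [← h1, ← h2, hTφ _ (IndexLogic.agreeOn_structPQ hl hm),
      hTφ _ (IndexLogic.agreeOn_structPQ hm hl)]
  rcases lt_or_gt_of_ne hlm with h | h
  · exact lt_asymm h (h3.mp h)
  · exact lt_asymm h (h3.mpr h)
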